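/- **Setting.** Region $i\in\{1,2\}$ has a finite set $B_i$ of buses and a finite set $L_i$ of lines, a generation cost $c_i(g)=g^\top H_i g+a_i^\top g$ with $H_i$ positive definite, a nonempty closed convex set $\mathcal G_i\subseteq\mathbb R^{B_i}$ of generator constraints, a shift factor matrix $S_i\in\mathbb R^{L_i\times B_i}$, a shift factor vector $S_{qi}\in\mathbb R^{L_i}$ and transmission limits $F_i\in\mathbb R^{L_i}$. The loads $d_1,d_2$ are random vectors on a common probability space, with arbitrary joint law; $q$ is the interchange from region 1 to region 2 and $Q\in\mathbb R$ the interface limit. With $\sigma_1=1$ and $\sigma_2=-1$, the regional dispatch problem $(P_{2i})$ at $(q,d_i)$ is $$\min_{g\in\mathcal G_i} c_i(g)\quad\text{s.t.}\quad \mathbf 1^\top(d_i-g)+\sigma_i q=0\ (\lambda_i),\qquad S_i(d_i-g)+\sigma_i S_{qi}\,q\le F_i\ (\mu_i).$$ Let $g_i^*(q,d_i)$ be its optimizer. An optimal dual solution $(\lambda_i^*,\mu_i^*)(q,d_i)$ is a maximizer, over $\lambda\in\mathbb R$ and $\mu\ge 0$, of $\inf_{g\in\mathcal G_i}\{c_i(g)+\lambda(\mathbf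 1^\top(d_i-g)+\sigma_i q)+\mu^\top(S_i(d_i-g)+\sigma_i S_{qi}q-F_i)\}$. The proxy bus price is $\pi_i(q,d_i)=\lambda_i^*+S_{qi}^\top\mu_i^*$. Let $\mathcal Q$ be the set of admissible interchanges: all $q\le Q$ for which $(P_{21})$ and $(P_{22})$ are almost surely feasible. Assume that $0\in\mathcal Q$ and that $c_1(g_1^*(q,d_1))$ and $c_2(g_2^*(q,d_2))$ have finite expectation for every $q\in\mathcal Q$. Consider $$(P_4)\ \min_{q\in\mathcal Q}\ \mathbb E\big[c_1(g_1^*(q,d_1))+c_2(g_2^*(q,d_2))\big],\qquad (P_5)\ \max_{q\in\mathcal Q}\ \int_0^q\big(\mathbb E[\pi_2(x,d_2)]-\mathbb E[\pi_1(x,d_1)]\big)\,dx .$$ **Theorem.** Suppose that for every $q$ in the interior of $\mathcal Q$, almost surely, $(P_{21})$ and $(P_{22})$ each have exactly one optimal dual solution. (If the optimal dual solutions exist and are unique for all $q\le Q$, then $\mathcal Q=(-\infty,Q]$.) Then: 1. $\pi_1(q,d_1)$ and $\pi_2(q,d_2)$ are integrable for every $q$ in the interior of $\mathcal Q$, and the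 integrand in $(P_5)$ is integrable between $0$ and $q$ for every $q\in\mathcal Q$. 2. $(P_4)$ and $(P_5)$ have the same optimizer: there is $q^*$ which is the unique optimizer of $(P_4)$ and the unique optimizer of $(P_5)$. 3. A point $q$ in the interior of $\mathcal Q$ is this optimizer if and only if the expected supply and demand curves intersect there: $\mathbb E[\pi_1(q,d_1)]=\mathbb E[\pi_2(q,d_2)]$. -/

import Mathlib

open MeasureTheory Matrix

noncomputable section

/-- The data of one control region under the proxy bus model: `B` is the set of buses and `L` the
set of transmission lines (internal lines and interface).  The generation cost is
`c(g) = gᵀ H g + aᵀ g` with `H` positive definite; the generator constraints `gen` form a nonempty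
closed convex set (a box of capacity limits, a polyhedron, ...). -/
structure Region (B L : Type*) [Fintype B] [Fintype L] where
  /-- quadratic cost coefficients -/
  H : Matrix B B ℝ
  /-- linear cost coefficients -/
  a : B → ℝ
  /-- shift factors of the buses to the lines -/
  S : Matrix L B ℝ
  /-- shift factors of the interchange to the lines -/
  Sq : L → ℝ
  /-- transmission limits -/
  F : L → ℝ
  /-- generator constraints -/
  gen : Set (B → ℝ)
  posDef : H.PosDef
  gen_nonempty : gen.Nonempty
  gen_closed : IsClosed gen
  gen_convex : Convex ℝ gen

namespace Region

variable {B L : Type*} [Fintype B] [Fintype L] (R : Region B L)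

/-- The generation cost `c(g) = gᵀ H g + aᵀ g`. -/
def cost (g : B → ℝ) : ℝ := g ⬝ᵥ (R.H *ᵥ g) + R.a ⬝ᵥ g

/-- The residual `1ᵀ(d - g) + e` of the power balance constraint, for net export `e`. -/
def balance (e : ℝ) (d g : B → ℝ) : ℝ := ∑ b, (d b - g b) + e

/-- The residual `S (d - g) + S_q e - F` of the transmission constraints, for net export `e`. -/
def overload (e : ℝ) (d g : B → ℝ) : L → ℝ := R.S *ᵥ (d - g) + e • R.Sq - R.F

/-- The feasible set of the regional dispatch problem with net export `e` and load `d`. -/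
def feasible (e : ℝ) (d : B → ℝ) : Set (B → ℝ) :=
  {g | g ∈ R.gen ∧ balance e d g = 0 ∧ R.overload e d g ≤ 0}

/-- `g` solves the regional dispatch problem: it minimizes the cost over the feasible set. -/
def IsOptimalDispatch (e : ℝ) (d g : B → ℝ) : Prop :=
  g ∈ R.feasible e d ∧ IsMinOn R.cost (R.feasible e d) g

/-- The optimal dispatch `g*` (it exists and is unique as soon as the problem is feasible). -/
def optDispatch (e : ℝ) (d : B → ℝ) : B → ℝ := Classical.epsilon (R.IsOptimalDispatch e d)

/-- The optimal generation cost `c(g*)`. -/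
def optCost (e : ℝ) (d : B → ℝ) : ℝ := R.cost (R.optDispatch e d)

/-- The Lagrangian: `p.1` is the multiplier of the power balance and `p.2` the vector of
multipliers of the transmission constraints; the generator constraints are kept explicit. -/
def lagrangian (e : ℝ) (d g : B → ℝ) (p : ℝ × (L → ℝ)) : ℝ :=
  R.cost g + p.1 * balance e d g + p.2 ⬝ᵥ R.overload e d g

/-- The dual function `inf_{g ∈ gen} L(g, p)`.  The infimum is finite for every `p`, because the
cost is strongly convex and `gen` is nonempty. -/
def dualFun (e : ℝ) (d : B → ℝ) (p : ℝ × (L → ℝ)) : ℝ :=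
  ⨅ g : R.gen, R.lagrangian e d g p

/-- `p = (λ, μ)` is an optimal dual solution of the regional dispatch problem: it maximizes the
dual function over all `(λ, μ)` with `μ ≥ 0`. -/
def IsOptimalDual (e : ℝ) (d : B → ℝ) (p : ℝ × (L → ℝ)) : Prop :=
  0 ≤ p.2 ∧ ∀ p' : ℝ × (L → ℝ), 0 ≤ p'.2 → R.dualFun e d p' ≤ R.dualFun e d p

/-- The optimal dual solution `(λ*, μ*)` (an arbitrary one, should there be several). -/
def optDual (e : ℝ) (d : B → ℝ) : ℝ × (L → ℝ) := Classical.epsilon (R.IsOptimalDual e d)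

/-- The locational marginal price `π = λ* + S_qᵀ μ*` at the proxy bus. -/
def price (e : ℝ) (d : B → ℝ) : ℝ := (R.optDual e d).1 + R.Sq ⬝ᵥ (R.optDual e d).2

end Region

/-- Two regions with interface limit `Q`.  The interchange `q` is the net flow from region 1 to
region 2, so the net export is `q` for region 1 and `-q` for region 2. -/
structure TwoRegionSystem (B₁ L₁ B₂ L₂ : Type*)
    [Fintype B₁] [Fintype L₁] [Fintype B₂] [Fintype L₂] where
  R₁ : Region B₁ L₁
  R₂ : Region B₂ L₂
  /-- interface limit -/
  Q : ℝ

namespace TwoRegionSystem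

variable {B₁ L₁ B₂ L₂ : Type*} [Fintype B₁] [Fintype L₁] [Fintype B₂] [Fintype L₂]
  (T : TwoRegionSystem B₁ L₁ B₂ L₂)

/-- The optimal cost of region 1 at interchange `q` and load `d`. -/
def cost₁ (q : ℝ) (d : B₁ → ℝ) : ℝ := T.R₁.optCost q d

/-- The optimal cost of region 2 at interchange `q` and load `d`. -/
def cost₂ (q : ℝ) (d : B₂ → ℝ) : ℝ := T.R₂.optCost (-q) d

/-- The proxy bus price `π₁(q, d)` of region 1. -/
def price₁ (q : ℝ) (d : B₁ → ℝ) : ℝ := T.R₁.price q d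

/-- The proxy bus price `π₂(q, d)` of region 2. -/
def price₂ (q : ℝ) (d : B₂ → ℝ) : ℝ := T.R₂.price (-q) d

variable {Ω : Type*} [MeasurableSpace Ω] (P : Measure Ω) (d₁ : Ω → B₁ → ℝ) (d₂ : Ω → B₂ → ℝ)

/-- The admissible interchange levels: those `q ≤ Q` at which both regional dispatch problems are
almost surely feasible (elsewhere the objectives below are meaningless). -/
def admissible : Set ℝ :=
  {q | q ≤ T.Q ∧ ∀ᵐ ω ∂P,
    (T.R₁.feasible q (d₁ ω)).Nonempty ∧ (T.R₂.feasible (-q) (d₂ ω)).Nonempty}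

/-- The expected total generation cost at interchange `q`. -/
def expectedCost (q : ℝ) : ℝ := ∫ ω, (T.cost₁ q (d₁ ω) + T.cost₂ q (d₂ ω)) ∂P

/-- The expected supply curve `E[π₁(q, d₁)]`. -/
def expectedPrice₁ (q : ℝ) : ℝ := ∫ ω, T.price₁ q (d₁ ω) ∂P

/-- The expected demand curve `E[π₂(q, d₂)]`. -/
def expectedPrice₂ (q : ℝ) : ℝ := ∫ ω, T.price₂ q (d₂ ω) ∂P

/-- The expected social welfare `∫₀^q (E[π₂(x, d₂)] - E[π₁(x, d₁)]) dx`. -/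
def welfare (q : ℝ) : ℝ :=
  ∫ x in (0 : ℝ)..q, (T.expectedPrice₂ P d₂ x - T.expectedPrice₁ P d₁ x)

/-- `q` is an optimizer of the two-stage stochastic problem. -/
def IsStochasticOptimizer (q : ℝ) : Prop :=
  q ∈ T.admissible P d₁ d₂ ∧ IsMinOn (T.expectedCost P d₁ d₂) (T.admissible P d₁ d₂) q

/-- `q` is an optimizer of the deterministic welfare problem. -/
def IsWelfareOptimizer (q : ℝ) : Prop :=
  q ∈ T.admissible P d₁ d₂ ∧ IsMaxOn (T.welfare P d₁ d₂) (T.admissible P d₁ d₂) q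

end TwoRegionSystem

end

/-! For a fixed load, the optimal cost of a region is strictly convex in the net export `e`, because
the balance forces different dispatches at different exports and the cost is strictly convex.
Changing `e` adds to the dual function a term linear in the multipliers, namely a multiple of
`proxyPrice` (`dualFun_eq_add`). Strong duality holds without constraint qualification, since
coercivity of the cost closes the perturbation epigraph. With a unique dual maximizer, an envelope
argument then makes the price the derivative of the optimal cost (`hasDerivAt_optCost`).

Let `W` be the expected total cost. Slopes of convex functions supply an integrable bound, so
differentiation passes under the expectation and `W' = E[π₁] - E[π₂]` in the interior; the minus
sign comes from the export `-q` of region 2. Fatou's lemma makes the sublevel sets of the strictly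
convex `W` closed and bounded, so `W` has exactly one minimizer. Continuity of `W` up to the ends of
closed intervals gives `welfare q = W 0 - W q`: maximizing welfare is minimizing `W`, and interior
optimality is `W' = 0`. -/

noncomputable section

open Filter Topology Set

/-! ### Analytic tools: perturbed maximization, convex integrands, Fatou, quadratic forms. -/

/-- Sensitivity of a concave maximization problem with a unique maximizer: under a small linear
perturbation `h • ℓ` of the objective, the optimal value grows at the rate `ℓ p₀`. -/
theorem exists_perturbed_le_of_unique_isMaxOn {E : Type*} [NormedAddCommGroup E] [NormedSpace ℝ E]
    [FiniteDimensional ℝ E] {K : Set E} (hK : IsClosed K) {φ : E → ℝ} (hφ : ConcaveOn ℝ K φ)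
    (hus : UpperSemicontinuousOn φ K) {p₀ : E} (hp₀ : p₀ ∈ K)
    (hmax : ∀ p ∈ K, p ≠ p₀ → φ p < φ p₀) (ℓ : E →L[ℝ] ℝ) {ε : ℝ} (hε : 0 < ε) :
    ∃ δ > 0, ∀ h : ℝ, |h| ≤ δ → ∀ p ∈ K, φ p + h * ℓ p ≤ φ p₀ + h * ℓ p₀ + ε * |h| := by
  have hN : 0 < ‖ℓ‖ + 1 := by positivity
  -- Within radius `r` the linear term varies by at most `ε * |h|`; the `+ 1` covers `ℓ = 0`.
  set r : ℝ := ε / (‖ℓ‖ + 1) with hr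
  have hr0 : 0 < r := by positivity
  have hrN : ‖ℓ‖ * r ≤ ε := by
    rw [hr, mul_div_assoc', div_le_iff₀ hN]
    nlinarith
  obtain ⟨η, hη, hsph⟩ : ∃ η > 0, ∀ x ∈ K ∩ Metric.sphere p₀ r, φ x ≤ φ p₀ - η := by
    rcases (K ∩ Metric.sphere p₀ r).eq_empty_or_nonempty with he | hne
    · exact ⟨1, one_pos, by simp [he]⟩
    · obtain ⟨x, hx, hxm⟩ := (hus.mono inter_subset_left).exists_isMaxOn hne
        ((isCompact_sphere p₀ r).inter_left hK)
      refine ⟨φ p₀ - φ x, sub_pos.2 (hmax x hx.1 ?_), fun y hy => ?_⟩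
      · rintro rfl
        have := hx.2
        simp [hr0.ne] at this
      · have := hxm hy
        simp only [mem_ofPred_eq] at this
        linarith
  refine ⟨η / (r * (‖ℓ‖ + 1)), by positivity, fun h hh p hp => ?_⟩
  have hlin : h * ℓ p - h * ℓ p₀ ≤ |h| * (‖ℓ‖ * ‖p - p₀‖) := by
    rw [← mul_sub, ← map_sub]
    calc h * ℓ (p - p₀) ≤ |h * ℓ (p - p₀)| := le_abs_self _
      _ = |h| * ‖ℓ (p - p₀)‖ := by rw [abs_mul, Real.norm_eq_abs]
      _ ≤ _ := by gcongr; exact ℓ.le_opNorm _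
  rcases le_total ‖p - p₀‖ r with hpr | hpr
  · have h1 : φ p ≤ φ p₀ := by
      by_cases h : p = p₀
      · rw [h]
      · exact (hmax p hp h).le
    have h2 : |h| * (‖ℓ‖ * ‖p - p₀‖) ≤ |h| * ε := by
      gcongr
      exact (mul_le_mul_of_nonneg_left hpr (norm_nonneg _)).trans hrN
    linarith
  -- Pull `p` back to the sphere along the segment to `p₀`: by concavity the gap `η` found there
  -- grows at least linearly with distance, and `δ` is small enough for it to absorb the linear
  -- term.
  · have hn : 0 < ‖p - p₀‖ := hr0.trans_le hpr
    set s : ℝ := r / ‖p - p₀‖ with hs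
    have hs0 : 0 < s := by positivity
    have hs1 : s ≤ 1 := (div_le_one hn).2 hpr
    have hsn : s * ‖p - p₀‖ = r := div_mul_cancel₀ _ hn.ne'
    have hx : (1 - s) • p₀ + s • p ∈ K :=
      hφ.1 hp₀ hp (by linarith) hs0.le (by ring)
    have hxs : (1 - s) • p₀ + s • p ∈ Metric.sphere p₀ r := by
      have : (1 - s) • p₀ + s • p - p₀ = s • (p - p₀) := by
        rw [sub_smul, one_smul, smul_sub]; abel
      rw [mem_sphere_iff_norm, this, norm_smul, Real.norm_eq_abs, abs_of_pos hs0, hsn]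
    have h1 := hφ.2 hp₀ hp (by linarith : 0 ≤ 1 - s) hs0.le (by ring)
    have h2 := hsph _ ⟨hx, hxs⟩
    simp only [smul_eq_mul] at h1
    have h3 : s * (φ p - φ p₀) ≤ -η := by linarith
    have h4 : |h| * (‖ℓ‖ * r) ≤ η := by
      rw [le_div_iff₀ (by positivity)] at hh
      nlinarith [abs_nonneg h, hr0, mul_nonneg (abs_nonneg h) hr0.le]
    have h5 : s * (|h| * (‖ℓ‖ * ‖p - p₀‖)) ≤ η := by
      rw [← hsn] at h4
      linarith
    have h6 : φ p - φ p₀ + |h| * (‖ℓ‖ * ‖p - p₀‖) ≤ 0 := by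
      by_contra! hc
      nlinarith
    have : 0 ≤ ε * |h| := by positivity
    linarith

/-- A convex combination of two points of an open interval of convexity controls all difference
quotients at `q`. -/
theorem ConvexOn.abs_slope_le {f : ℝ → ℝ} {q δ y : ℝ} (hδ : 0 < δ)
    (hf : ConvexOn ℝ (Icc (q - δ) (q + δ)) f) (hy : y ∈ Icc (q - δ) (q + δ)) (hyq : y ≠ q) :
    |(f y - f q) / (y - q)| ≤
      |(f (q - δ) - f q) / (q - δ - q)| + |(f (q + δ) - f q) / (q + δ - q)| := by
  have hq : q ∈ Icc (q - δ) (q + δ) := ⟨by linarith, by linarith⟩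
  have h1 := hf.secant_mono hq ⟨le_rfl, by linarith⟩ hy (by linarith) hyq hy.1
  have h2 := hf.secant_mono hq hy ⟨by linarith, le_rfl⟩ hyq (by linarith) hy.2
  rw [abs_le]
  constructor
  · linarith [neg_abs_le ((f (q - δ) - f q) / (q - δ - q)),
      abs_nonneg ((f (q + δ) - f q) / (q + δ - q))]
  · linarith [le_abs_self ((f (q + δ) - f q) / (q + δ - q)),
      abs_nonneg ((f (q - δ) - f q) / (q - δ - q))]

/-- Differentiation under the integral sign for convex integrands; the integrability of the
derivative is part of the conclusion. -/
theorem hasDerivAt_integral_of_ae_convexOn {Ω : Type*} [MeasurableSpace Ω] {P : Measure Ω}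
    {f : ℝ → Ω → ℝ} {f' : Ω → ℝ} {q δ : ℝ} (hδ : 0 < δ)
    (hconv : ∀ᵐ ω ∂P, ConvexOn ℝ (Icc (q - δ) (q + δ)) fun x => f x ω)
    (hint : ∀ x ∈ Icc (q - δ) (q + δ), Integrable (f x) P)
    (hderiv : ∀ᵐ ω ∂P, HasDerivAt (fun x => f x ω) (f' ω) q) :
    Integrable f' P ∧ HasDerivAt (fun x => ∫ ω, f x ω ∂P) (∫ ω, f' ω ∂P) q := by
  have hq : q ∈ Icc (q - δ) (q + δ) := ⟨by linarith, by linarith⟩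
  set bound : Ω → ℝ := fun ω => |(f (q - δ) ω - f q ω) / (q - δ - q)| +
    |(f (q + δ) ω - f q ω) / (q + δ - q)| with hbound
  have hbi : Integrable bound P :=
    ((((hint _ ⟨le_rfl, by linarith⟩).sub (hint _ hq)).div_const _).abs).add
      ((((hint _ ⟨by linarith, le_rfl⟩).sub (hint _ hq)).div_const _).abs)
  have hev : ∀ᶠ x in 𝓝[≠] q, x ∈ Icc (q - δ) (q + δ) ∧ x ≠ q :=
    (eventually_nhdsWithin_of_eventually_nhds
      (Icc_mem_nhds (by linarith) (by linarith))).and eventually_mem_nhdsWithin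
  have hsl : ∀ x ∈ Icc (q - δ) (q + δ), Integrable (fun ω => (f x ω - f q ω) / (x - q)) P :=
    fun x hx => ((hint x hx).sub (hint q hq)).div_const _
  have hlim : ∀ᵐ ω ∂P, Tendsto (fun x => (f x ω - f q ω) / (x - q)) (𝓝[≠] q) (𝓝 (f' ω)) := by
    filter_upwards [hderiv] with ω hω
    have := hasDerivAt_iff_tendsto_slope.1 hω
    simpa only [slope_fun_def_field] using this
  have hbd : ∀ᶠ x in 𝓝[≠] q, ∀ᵐ ω ∂P, ‖(f x ω - f q ω) / (x - q)‖ ≤ bound ω := by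
    filter_upwards [hev] with x hx
    filter_upwards [hconv] with ω hω
    exact hω.abs_slope_le hδ hx.1 hx.2
  have hle : ∀ᵐ ω ∂P, ‖f' ω‖ ≤ bound ω := by
    filter_upwards [hconv, hlim] with ω hω hl
    refine le_of_tendsto hl.norm ?_
    filter_upwards [hev] with x hx
    exact hω.abs_slope_le hδ hx.1 hx.2
  -- Measurability of `f'` needs a countable limit; the shift by `N` keeps every term in the
  -- interval of integrability.
  obtain ⟨u, hu⟩ := exists_seq_tendsto (𝓝[≠] q)
  obtain ⟨N, hN⟩ := eventually_atTop.1 (hu.eventually hev)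
  have hmeas : AEStronglyMeasurable f' P := by
    refine aestronglyMeasurable_of_tendsto_ae atTop
      (f := fun n ω => (f (u (n + N)) ω - f q ω) / (u (n + N) - q))
      (fun n => (hsl _ (hN _ (by omega)).1).aestronglyMeasurable) ?_
    filter_upwards [hlim] with ω hω
    exact hω.comp (hu.comp (tendsto_add_atTop_nat N))
  refine ⟨hbi.mono' hmeas hle, hasDerivAt_iff_tendsto_slope.2 ?_⟩
  have := tendsto_integral_filter_of_dominated_convergence (μ := P) (l := 𝓝[≠] q) bound
    (hev.mono fun x hx => (hsl x hx.1).aestronglyMeasurable) hbd hbi hlim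
  refine this.congr' ?_
  filter_upwards [hev] with x hx
  rw [slope_def_field, integral_div, integral_sub (hint x hx.1) (hint q hq)]

/-- Fatou's lemma for real sequences: if the integrals of functions with a common lower bound stay
bounded by `M`, then the functions return infinitely often to any level above some integrable `F`
with integral at most `M`. -/
theorem exists_integrable_forall_frequently_lt {Ω : Type*} [MeasurableSpace Ω] {P : Measure Ω}
    [IsProbabilityMeasure P] {f : ℕ → Ω → ℝ} {κ M : ℝ} (hf : ∀ n, Integrable (f n) P)
    (hκ : ∀ n, ∀ᵐ ω ∂P, κ ≤ f n ω) (hM : ∀ n, ∫ ω, f n ω ∂P ≤ M) :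
    ∃ F : Ω → ℝ, Integrable F P ∧ ∫ ω, F ω ∂P ≤ M ∧
      ∀ᵐ ω ∂P, ∀ t, F ω < t → ∃ᶠ n in atTop, f n ω < t := by
  -- Subtracting `κ` makes the functions nonnegative almost everywhere, so `ENNReal.ofReal`
  -- truncates nothing there.
  set G : Ω → ENNReal := fun ω => liminf (fun n => ENNReal.ofReal (f n ω - κ)) atTop with hG
  have hgi : ∀ n, Integrable (fun ω => f n ω - κ) P := fun n => (hf n).sub (integrable_const _)
  have hme : ∀ n, AEMeasurable (fun ω => ENNReal.ofReal (f n ω - κ)) P :=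
    fun n => (hgi n).aemeasurable.ennreal_ofReal
  have hκM : ∀ n, ∫⁻ ω, ENNReal.ofReal (f n ω - κ) ∂P ≤ ENNReal.ofReal (M - κ) := by
    intro n
    rw [← ofReal_integral_eq_lintegral_ofReal (hgi n)
      ((hκ n).mono fun ω h => sub_nonneg.2 h), integral_sub (hf n) (integrable_const _)]
    simpa using ENNReal.ofReal_le_ofReal (sub_le_sub_right (hM n) κ)
  have hGle : ∫⁻ ω, G ω ∂P ≤ ENNReal.ofReal (M - κ) := by
    refine (lintegral_liminf_le' hme).trans ?_
    exact liminf_le_of_le (by isBoundedDefault) fun b hb => by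
      obtain ⟨n, hn⟩ := hb.exists
      exact hn.trans (hκM n)
  have hGm : AEMeasurable G P := by
    simp only [hG, liminf_eq_iSup_iInf_of_nat']
    exact AEMeasurable.iSup fun n => AEMeasurable.iInf fun i => hme (i + n)
  have hGfin : ∀ᵐ ω ∂P, G ω < ⊤ :=
    ae_lt_top' hGm (hGle.trans_lt ENNReal.ofReal_lt_top).ne
  have hGi : Integrable (fun ω => (G ω).toReal) P :=
    integrable_toReal_of_lintegral_ne_top hGm (hGle.trans_lt ENNReal.ofReal_lt_top).ne
  refine ⟨fun ω => (G ω).toReal + κ, hGi.add (integrable_const _), ?_, ?_⟩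
  · rw [integral_add hGi (integrable_const _), integral_toReal hGm hGfin]
    have hMκ : κ ≤ M := by
      refine le_trans ?_ (hM 0)
      simpa using integral_mono_ae (integrable_const κ) (hf 0) (hκ 0)
    have := ENNReal.toReal_mono ENNReal.ofReal_ne_top hGle
    rw [ENNReal.toReal_ofReal (sub_nonneg.2 hMκ)] at this
    simpa using by linarith
  · filter_upwards [hGfin] with ω hω t ht
    have h1 : G ω < ENNReal.ofReal (t - κ) := by
      rw [ENNReal.lt_ofReal_iff_toReal_lt hω.ne]
      linarith
    refine (frequently_lt_of_liminf_lt (by isBoundedDefault) h1).mono fun n hn => ?_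
    have := (ENNReal.ofReal_lt_ofReal_iff'.1 hn).1
    linarith

/-- A positive definite quadratic form dominates a multiple of the squared norm. -/
theorem Matrix.PosDef.exists_mul_sq_norm_le {n : Type*} [Fintype n] {H : Matrix n n ℝ}
    (hH : H.PosDef) : ∃ c > 0, ∀ g : n → ℝ, c * ‖g‖ ^ 2 ≤ g ⬝ᵥ (H *ᵥ g) := by
  have hpos : ∀ g : n → ℝ, g ≠ 0 → 0 < g ⬝ᵥ (H *ᵥ g) := fun g hg => by
    simpa using (Matrix.posDef_iff_dotProduct_mulVec.1 hH).2 hg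
  have hcont : Continuous fun g : n → ℝ => g ⬝ᵥ (H *ᵥ g) :=
    continuous_id.dotProduct (continuous_const.matrix_mulVec continuous_id)
  obtain ⟨c, hc, hsph⟩ : ∃ c > 0, ∀ g ∈ Metric.sphere (0 : n → ℝ) 1, c ≤ g ⬝ᵥ (H *ᵥ g) := by
    rcases (Metric.sphere (0 : n → ℝ) 1).eq_empty_or_nonempty with he | hne
    · exact ⟨1, one_pos, by simp [he]⟩
    · obtain ⟨x, hx, hm⟩ := (isCompact_sphere (0 : n → ℝ) 1).exists_isMinOn hne hcont.continuousOn
      exact ⟨_, hpos x (Metric.ne_of_mem_sphere hx one_ne_zero), fun g hg => hm hg⟩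
  refine ⟨c, hc, fun g => ?_⟩
  by_cases hg : g = 0
  · simp [hg]
  · have hn : 0 < ‖g‖ := norm_pos_iff.2 hg
    have := hsph (‖g‖⁻¹ • g) (by simp [norm_smul, hn.ne'])
    rw [mulVec_smul, smul_dotProduct, dotProduct_smul, smul_eq_mul, smul_eq_mul] at this
    have h2 : g ⬝ᵥ (H *ᵥ g) = ‖g‖ ^ 2 * (‖g‖⁻¹ * (‖g‖⁻¹ * g ⬝ᵥ (H *ᵥ g))) := by
      field_simp
    rw [h2, mul_comm c]
    gcongr

/-! ### The regional problem: coercivity, closedness and convexity. -/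

namespace Region

variable {B L : Type*} [Fintype B] [Fintype L] (R : Region B L)

theorem continuous_cost : Continuous R.cost :=
  (continuous_id.dotProduct (continuous_const.matrix_mulVec continuous_id)).add
    (continuous_const.dotProduct continuous_id)

theorem continuous_balance (e : ℝ) (d : B → ℝ) : Continuous (balance e d) := by
  unfold balance
  fun_prop

theorem continuous_overload (e : ℝ) (d : B → ℝ) : Continuous (R.overload e d) := by
  unfold overload
  exact ((continuous_const.matrix_mulVec (continuous_const.sub continuous_id)).add
    continuous_const).sub continuous_const

/-- Young's inequality absorbs all linear terms into half of the quadratic form. A general `φ` is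
allowed so that the linear part of the Lagrangian is covered too. -/
theorem exists_mul_sq_norm_sub_le_cost_add (φ : (B → ℝ) →L[ℝ] ℝ) :
    ∃ c > 0, ∃ κ, ∀ g, c * ‖g‖ ^ 2 - κ ≤ R.cost g + φ g := by
  obtain ⟨c, hc, h⟩ := R.posDef.exists_mul_sq_norm_le
  set ψ : (B → ℝ) →L[ℝ] ℝ := LinearMap.toContinuousLinearMap
    { toFun := fun g => R.a ⬝ᵥ g + φ g
      map_add' := fun x y => by simp [dotProduct_add]; ring
      map_smul' := fun x y => by simp [dotProduct_smul]; ring } with hψ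
  have hψv : ∀ g, ψ g = R.a ⬝ᵥ g + φ g := fun g => rfl
  refine ⟨c / 2, by positivity, ‖ψ‖ ^ 2 / (2 * c), fun g => ?_⟩
  have h1 : |ψ g| ≤ ‖ψ‖ * ‖g‖ := ψ.le_opNorm g
  have h2 := neg_abs_le (ψ g)
  have h3 : ‖ψ‖ * ‖g‖ ≤ c / 2 * ‖g‖ ^ 2 + ‖ψ‖ ^ 2 / (2 * c) := by
    have : c / 2 * ‖g‖ ^ 2 + ‖ψ‖ ^ 2 / (2 * c) - ‖ψ‖ * ‖g‖ =
      (c * ‖g‖ - ‖ψ‖) ^ 2 / (2 * c) := by field_simp; ring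
    have : 0 ≤ (c * ‖g‖ - ‖ψ‖) ^ 2 / (2 * c) := by positivity
    linarith
  have h4 := h g
  rw [hψv] at h1 h2
  unfold cost
  linarith

theorem exists_mul_sq_norm_sub_le_cost : ∃ c > 0, ∃ κ, ∀ g, c * ‖g‖ ^ 2 - κ ≤ R.cost g := by
  simpa using R.exists_mul_sq_norm_sub_le_cost_add 0

theorem isBounded_cost_le (t : ℝ) : Bornology.IsBounded {g | R.cost g ≤ t} := by
  obtain ⟨c, hc, κ, h⟩ := R.exists_mul_sq_norm_sub_le_cost
  refine (Metric.isBounded_closedBall (x := (0 : B → ℝ)) (r := (t + κ) / c + 1)).subset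
    fun g hg => ?_
  have hg' : R.cost g ≤ t := hg
  have h1 : ‖g‖ ^ 2 ≤ (t + κ) / c := by
    rw [le_div_iff₀ hc]
    linarith [h g]
  rw [mem_closedBall_zero_iff]
  nlinarith [sq_nonneg (‖g‖ - 1)]

/-- The convexity gap is exactly `a * b` times the quadratic form at `x - y`. -/
theorem cost_combo_lt {x y : B → ℝ} (hxy : x ≠ y) {a b : ℝ} (ha : 0 < a) (hb : 0 < b)
    (hab : a + b = 1) : R.cost (a • x + b • y) < a * R.cost x + b * R.cost y := by
  have hpos : 0 < (x - y) ⬝ᵥ (R.H *ᵥ (x - y)) := by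
    simpa using (Matrix.posDef_iff_dotProduct_mulVec.1 R.posDef).2 (sub_ne_zero.2 hxy)
  have hid : a * R.cost x + b * R.cost y - R.cost (a • x + b • y) =
      a * b * ((x - y) ⬝ᵥ (R.H *ᵥ (x - y))) := by
    obtain rfl : b = 1 - a := by linarith
    simp only [cost, mulVec_add, mulVec_sub, mulVec_smul, dotProduct_add, add_dotProduct,
      dotProduct_sub, sub_dotProduct, dotProduct_smul, smul_dotProduct, smul_eq_mul]
    ring
  have := mul_pos (mul_pos ha hb) hpos
  linarith

theorem cost_combo_le (x y : B → ℝ) {a b : ℝ} (ha : 0 ≤ a) (hb : 0 ≤ b)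
    (hab : a + b = 1) : R.cost (a • x + b • y) ≤ a * R.cost x + b * R.cost y := by
  rcases ha.eq_or_lt with rfl | ha
  · obtain rfl : b = 1 := by linarith
    simp
  rcases hb.eq_or_lt with rfl | hb
  · obtain rfl : a = 1 := by linarith
    simp
  by_cases hxy : x = y
  · subst hxy
    rw [← add_smul, ← add_mul, hab, one_smul, one_mul]
  · exact (R.cost_combo_lt hxy ha hb hab).le

theorem balance_combo (e e' : ℝ) (d x y : B → ℝ) {a b : ℝ} (hab : a + b = 1) :
    balance (a * e + b * e') d (a • x + b • y) = a * balance e d x + b * balance e' d y := by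
  obtain rfl : b = 1 - a := by linarith
  simp only [balance, Finset.sum_sub_distrib, Pi.add_apply, Pi.smul_apply, smul_eq_mul,
    Finset.sum_add_distrib, ← Finset.mul_sum]
  ring

theorem overload_combo (e e' : ℝ) (d x y : B → ℝ) {a b : ℝ} (hab : a + b = 1) :
    R.overload (a * e + b * e') d (a • x + b • y) =
      a • R.overload e d x + b • R.overload e' d y := by
  obtain rfl : b = 1 - a := by linarith
  simp only [overload, mulVec_sub, mulVec_add, mulVec_smul]
  ext l
  simp
  ring

theorem balance_eq_add (e e' : ℝ) (d g : B → ℝ) :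
    balance e d g = balance e' d g + (e - e') := by
  simp [balance]

theorem overload_eq_add (e e' : ℝ) (d g : B → ℝ) :
    R.overload e d g = R.overload e' d g + (e - e') • R.Sq := by
  simp only [overload, sub_smul]
  abel

/-- The epigraph of the optimal cost as a function of right hand side perturbations of the balance
and transmission constraints. -/
def perturbationEpigraph (e : ℝ) (d : B → ℝ) : Set (ℝ × ℝ × (L → ℝ)) :=
  {x | ∃ g ∈ R.gen, R.cost g ≤ x.1 ∧ balance e d g = x.2.1 ∧ R.overload e d g ≤ x.2.2}

theorem convex_perturbationEpigraph (e : ℝ) (d : B → ℝ) :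
    Convex ℝ (R.perturbationEpigraph e d) := by
  rintro x ⟨g, hg, hg1, hg2, hg3⟩ y ⟨g', hg', hg1', hg2', hg3'⟩ a b ha hb hab
  have he : e = a * e + b * e := by rw [← add_mul, hab, one_mul]
  refine ⟨a • g + b • g', R.gen_convex hg hg' ha hb hab, ?_, ?_, ?_⟩
  · refine (R.cost_combo_le g g' ha hb hab).trans ?_
    simp only [Prod.fst_add, Prod.smul_fst, smul_eq_mul]
    gcongr
  · rw [he, balance_combo e e d g g' hab, hg2, hg2']
    simp
  · rw [he, R.overload_combo e e d g g' hab]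
    simp only [Prod.snd_add, Prod.smul_snd]
    gcongr

/-- Along a convergent sequence the costs are bounded, so by coercivity the dispatches subconverge.
This compactness is what replaces a constraint qualification in strong duality. -/
theorem isClosed_perturbationEpigraph (e : ℝ) (d : B → ℝ) :
    IsClosed (R.perturbationEpigraph e d) := by
  refine IsSeqClosed.isClosed fun x x₀ hx hlim => ?_
  choose g hg h1 h2 h3 using hx
  have hl1 : Tendsto (fun n => (x n).1) atTop (𝓝 x₀.1) :=
    (continuous_fst.tendsto _).comp hlim
  have hl2 : Tendsto (fun n => (x n).2.1) atTop (𝓝 x₀.2.1) :=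
    ((continuous_fst.comp continuous_snd).tendsto _).comp hlim
  have hl3 : Tendsto (fun n => (x n).2.2) atTop (𝓝 x₀.2.2) :=
    ((continuous_snd.comp continuous_snd).tendsto _).comp hlim
  obtain ⟨t, ht⟩ := hl1.bddAbove_range
  obtain ⟨g₀, -, u, hu, hgu⟩ := tendsto_subseq_of_bounded (R.isBounded_cost_le t)
    (fun n => (h1 n).trans (ht (mem_range_self n)))
  refine ⟨g₀, R.gen_closed.mem_of_tendsto hgu (Eventually.of_forall fun n => hg _), ?_, ?_, ?_⟩
  · exact le_of_tendsto_of_tendsto' ((R.continuous_cost.tendsto _).comp hgu)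
      (hl1.comp hu.tendsto_atTop) fun n => h1 _
  · exact tendsto_nhds_unique (((continuous_balance e d).tendsto _).comp hgu)
      ((hl2.comp hu.tendsto_atTop).congr fun n => (h2 _).symm)
  · exact le_of_tendsto_of_tendsto' (((R.continuous_overload e d).tendsto _).comp hgu)
      (hl3.comp hu.tendsto_atTop) fun n => h3 _

/-- A change of export is a right hand side perturbation along `(1, R.Sq)`, so a single epigraph
serves all exports. -/
theorem mem_perturbationEpigraph_iff (e e' t : ℝ) (d : B → ℝ) :
    (t, e' - e, (e' - e) • R.Sq) ∈ R.perturbationEpigraph e' d ↔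
      ∃ g ∈ R.feasible e d, R.cost g ≤ t := by
  refine exists_congr fun g => ?_
  have h1 : balance e' d g = e' - e ↔ balance e d g = 0 := by
    rw [balance_eq_add e e']
    constructor <;> intro <;> linarith
  have h2 : R.overload e' d g ≤ (e' - e) • R.Sq ↔ R.overload e d g ≤ 0 := by
    rw [R.overload_eq_add e e', ← neg_sub e' e, neg_smul, ← sub_eq_add_neg, sub_nonpos]
  simp only [feasible, mem_ofPred_eq, h1, h2]
  tauto

/-- The epigraph of the optimal cost as a function of the net export is closed. -/
theorem isClosed_epigraph (d : B → ℝ) :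
    IsClosed {x : ℝ × ℝ | ∃ g ∈ R.feasible x.1 d, R.cost g ≤ x.2} := by
  have : {x : ℝ × ℝ | ∃ g ∈ R.feasible x.1 d, R.cost g ≤ x.2} =
      (fun x : ℝ × ℝ => (x.2, 0 - x.1, (0 - x.1) • R.Sq)) ⁻¹' R.perturbationEpigraph 0 d := by
    ext x
    exact (R.mem_perturbationEpigraph_iff x.1 0 x.2 d).symm
  rw [this]
  exact (R.isClosed_perturbationEpigraph 0 d).preimage (by fun_prop)

theorem exists_isOptimalDispatch {e : ℝ} {d : B → ℝ} (h : (R.feasible e d).Nonempty) :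
    ∃ g, R.IsOptimalDispatch e d g := by
  obtain ⟨g₀, hg₀⟩ := h
  have hcl : IsClosed (R.feasible e d) := by
    refine R.gen_closed.inter (IsClosed.inter ?_ ?_)
    · exact isClosed_eq (continuous_balance e d) continuous_const
    · exact isClosed_le (R.continuous_overload e d) continuous_const
  have hK : IsCompact (R.feasible e d ∩ {g | R.cost g ≤ R.cost g₀}) :=
    Metric.isCompact_of_isClosed_isBounded
      (hcl.inter (isClosed_le R.continuous_cost continuous_const))
      ((R.isBounded_cost_le _).subset inter_subset_right)
  obtain ⟨g, hg, hm⟩ := hK.exists_isMinOn ⟨g₀, hg₀, le_refl (R.cost g₀)⟩ R.continuous_cost.continuousOn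
  refine ⟨g, hg.1, fun x hx => ?_⟩
  by_cases hx' : R.cost x ≤ R.cost g₀
  · exact hm ⟨hx, hx'⟩
  · exact hg.2.trans (not_le.1 hx').le

theorem isOptimalDispatch_optDispatch {e : ℝ} {d : B → ℝ} (h : (R.feasible e d).Nonempty) :
    R.IsOptimalDispatch e d (R.optDispatch e d) :=
  Classical.epsilon_spec (R.exists_isOptimalDispatch h)

theorem optCost_le {e : ℝ} {d g : B → ℝ} (hg : g ∈ R.feasible e d) :
    R.optCost e d ≤ R.cost g :=
  (R.isOptimalDispatch_optDispatch ⟨g, hg⟩).2 hg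

theorem exists_feasible_cost_le_iff {e t : ℝ} {d : B → ℝ} :
    (∃ g ∈ R.feasible e d, R.cost g ≤ t) ↔ (R.feasible e d).Nonempty ∧ R.optCost e d ≤ t :=
  ⟨fun ⟨g, hg, h⟩ => ⟨⟨g, hg⟩, (R.optCost_le hg).trans h⟩,
    fun ⟨h, ht⟩ => ⟨_, (R.isOptimalDispatch_optDispatch h).1, ht⟩⟩

theorem feasible_combo {e e' : ℝ} {d g g' : B → ℝ} (hg : g ∈ R.feasible e d)
    (hg' : g' ∈ R.feasible e' d) {a b : ℝ} (ha : 0 ≤ a) (hb : 0 ≤ b) (hab : a + b = 1) :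
    a • g + b • g' ∈ R.feasible (a * e + b * e') d := by
  refine ⟨R.gen_convex hg.1 hg'.1 ha hb hab, ?_, ?_⟩
  · rw [balance_combo _ _ _ _ _ hab, hg.2.1, hg'.2.1]
    simp
  · rw [R.overload_combo _ _ _ _ _ hab]
    have h1 := smul_le_smul_of_nonneg_left hg.2.2 ha
    have h2 := smul_le_smul_of_nonneg_left hg'.2.2 hb
    simpa using add_le_add h1 h2

/-- The optimal cost is strictly convex in the net export. -/
theorem strictConvexOn_optCost (d : B → ℝ) :
    StrictConvexOn ℝ {e | (R.feasible e d).Nonempty} fun e => R.optCost e d := by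
  refine ⟨?_, ?_⟩
  · rintro e ⟨g, hg⟩ e' ⟨g', hg'⟩ a b ha hb hab
    exact ⟨_, R.feasible_combo hg hg' ha hb hab⟩
  · intro e he e' he' hne a b ha hb hab
    have h := (R.isOptimalDispatch_optDispatch he).1
    have h' := (R.isOptimalDispatch_optDispatch he').1
    -- A dispatch optimal for both exports would satisfy both balances, forcing `e = e'`.
    refine (R.optCost_le (R.feasible_combo h h' ha.le hb.le hab)).trans_lt
      (R.cost_combo_lt (fun heq => hne ?_) ha hb hab)
    have h1 := h.2.1
    have h2 := h'.2.1
    rw [heq, balance_eq_add e e'] at h1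
    linarith

/-- A uniform lower bound of the optimal cost, over all net exports and loads. -/
theorem exists_forall_le_optCost : ∃ κ, ∀ e d, κ ≤ R.optCost e d := by
  obtain ⟨c, hc, κ, h⟩ := R.exists_mul_sq_norm_sub_le_cost
  refine ⟨-κ, fun e d => le_trans ?_ (h _)⟩
  have : 0 ≤ c * ‖R.optDispatch e d‖ ^ 2 := by positivity
  linarith

/-- The net exports whose optimal cost is at most `t` form a bounded set. -/
theorem isBounded_optCost_le (d : B → ℝ) (t : ℝ) :
    Bornology.IsBounded {e | (R.feasible e d).Nonempty ∧ R.optCost e d ≤ t} := by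
  have hK : IsCompact (closure {g | R.cost g ≤ t}) := (R.isBounded_cost_le t).isCompact_closure
  -- The balance recovers the export continuously from the dispatch, so bounded dispatches give
  -- bounded exports.
  have hc : Continuous fun g : B → ℝ => -∑ b, (d b - g b) := by fun_prop
  refine (hK.image hc).isBounded.subset ?_
  rintro e ⟨he, ht⟩
  refine ⟨R.optDispatch e d, subset_closure ht, ?_⟩
  have := (R.isOptimalDispatch_optDispatch he).1.2.1
  simp only [balance] at this
  linarith

end Region

/-! ### Lagrangian duality and the price as a derivative. -/

namespace Region

variable {B L : Type*} [Fintype B] [Fintype L] (R : Region B L)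

/-- The sensitivity `λ + S_qᵀ μ` of the Lagrangian to the net export. -/
def proxyPrice : (ℝ × (L → ℝ)) →L[ℝ] ℝ :=
  LinearMap.toContinuousLinearMap
    { toFun := fun p => p.1 + R.Sq ⬝ᵥ p.2
      map_add' := fun x y => by simp [dotProduct_add]; ring
      map_smul' := fun x y => by simp [dotProduct_smul]; ring }

theorem proxyPrice_apply (p : ℝ × (L → ℝ)) : R.proxyPrice p = p.1 + R.Sq ⬝ᵥ p.2 := rfl

theorem lagrangian_eq_add (e e' : ℝ) (d g : B → ℝ) (p : ℝ × (L → ℝ)) :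
    R.lagrangian e d g p = R.lagrangian e' d g p + (e - e') * R.proxyPrice p := by
  simp only [lagrangian, balance_eq_add e e', R.overload_eq_add e e', proxyPrice_apply,
    dotProduct_add, dotProduct_smul, smul_eq_mul, dotProduct_comm R.Sq p.2]
  ring

/-- In `g` the Lagrangian is the cost plus an affine function, hence coercive. This makes the real
infimum in `dualFun` a genuine one rather than a default value. -/
theorem bddBelow_lagrangian (e : ℝ) (d : B → ℝ) (p : ℝ × (L → ℝ)) :
    BddBelow (range fun g : R.gen => R.lagrangian e d g p) := by
  set φ : (B → ℝ) →L[ℝ] ℝ := LinearMap.toContinuousLinearMap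
    { toFun := fun g => -(p.1 * ∑ b, g b + p.2 ⬝ᵥ (R.S *ᵥ g))
      map_add' := fun x y => by
        simp [mulVec_add, dotProduct_add, Finset.sum_add_distrib]; ring
      map_smul' := fun x y => by
        simp [mulVec_smul, dotProduct_smul, ← Finset.mul_sum]; ring } with hφ
  have hφv : ∀ g, φ g = -(p.1 * ∑ b, g b + p.2 ⬝ᵥ (R.S *ᵥ g)) := fun g => rfl
  obtain ⟨c, hc, κ, h⟩ := R.exists_mul_sq_norm_sub_le_cost_add φ
  refine ⟨-κ + (p.1 * balance e d 0 + p.2 ⬝ᵥ R.overload e d 0), ?_⟩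
  rintro _ ⟨g, rfl⟩
  have h1 := h g
  have h2 : R.lagrangian e d g p = R.cost g + φ g +
      (p.1 * balance e d 0 + p.2 ⬝ᵥ R.overload e d 0) := by
    simp only [lagrangian, hφv, balance, overload, mulVec_sub, dotProduct_add, dotProduct_sub,
      Finset.sum_sub_distrib, mulVec_zero, Pi.zero_apply, Finset.sum_const_zero, dotProduct_zero]
    ring
  have h3 : 0 ≤ c * ‖(g : B → ℝ)‖ ^ 2 := by positivity
  simp only [h2]
  linarith

theorem dualFun_le_lagrangian (e : ℝ) (d : B → ℝ) (p : ℝ × (L → ℝ)) {g : B → ℝ}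
    (hg : g ∈ R.gen) : R.dualFun e d p ≤ R.lagrangian e d g p :=
  ciInf_le (R.bddBelow_lagrangian e d p) ⟨g, hg⟩

theorem le_dualFun {e : ℝ} {d : B → ℝ} {p : ℝ × (L → ℝ)} {m : ℝ}
    (h : ∀ g ∈ R.gen, m ≤ R.lagrangian e d g p) : m ≤ R.dualFun e d p :=
  haveI := R.gen_nonempty.to_subtype
  le_ciInf fun g => h g g.2

/-- The term by which the export changes the Lagrangian does not involve `g`, so it leaves the
infimum. Moving the export is thus a linear perturbation of the dual objective. -/
theorem dualFun_eq_add (e e' : ℝ) (d : B → ℝ) (p : ℝ × (L → ℝ)) :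
    R.dualFun e d p = R.dualFun e' d p + (e - e') * R.proxyPrice p := by
  refine le_antisymm ?_ ?_
  · rw [← sub_le_iff_le_add]
    refine R.le_dualFun fun g hg => ?_
    have := R.dualFun_le_lagrangian e d p hg
    rw [R.lagrangian_eq_add e e'] at this
    linarith
  · refine R.le_dualFun fun g hg => ?_
    rw [R.lagrangian_eq_add e e']
    have := R.dualFun_le_lagrangian e' d p hg
    linarith

theorem lagrangian_combo (e : ℝ) (d g : B → ℝ) (p p' : ℝ × (L → ℝ)) {a b : ℝ} (hab : a + b = 1) :
    R.lagrangian e d g (a • p + b • p') = a * R.lagrangian e d g p + b * R.lagrangian e d g p' := by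
  obtain rfl : b = 1 - a := by linarith
  simp only [lagrangian, Prod.fst_add, Prod.snd_add, Prod.smul_fst, Prod.smul_snd, add_dotProduct,
    smul_dotProduct, smul_eq_mul]
  ring

theorem concaveOn_dualFun (e : ℝ) (d : B → ℝ) : ConcaveOn ℝ univ (R.dualFun e d) := by
  refine ⟨convex_univ, fun p _ p' _ a b ha hb hab => R.le_dualFun fun g hg => ?_⟩
  rw [R.lagrangian_combo e d g p p' hab, smul_eq_mul, smul_eq_mul]
  have h1 := R.dualFun_le_lagrangian e d p hg
  have h2 := R.dualFun_le_lagrangian e d p' hg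
  gcongr

theorem upperSemicontinuous_dualFun (e : ℝ) (d : B → ℝ) :
    UpperSemicontinuous (R.dualFun e d) := by
  refine upperSemicontinuous_ciInf (R.bddBelow_lagrangian e d) fun g => ?_
  refine Continuous.upperSemicontinuous ?_
  unfold lagrangian
  exact (continuous_const.add (continuous_fst.mul continuous_const)).add
    (continuous_snd.dotProduct continuous_const)

/-- Weak duality. -/
theorem dualFun_le_optCost {e : ℝ} {d : B → ℝ} (h : (R.feasible e d).Nonempty)
    {p : ℝ × (L → ℝ)} (hp : 0 ≤ p.2) : R.dualFun e d p ≤ R.optCost e d := by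
  obtain ⟨⟨hg, hb, ho⟩, -⟩ := R.isOptimalDispatch_optDispatch h
  refine (R.dualFun_le_lagrangian e d p hg).trans ?_
  have : p.2 ⬝ᵥ R.overload e d (R.optDispatch e d) ≤ 0 :=
    Finset.sum_nonpos fun l _ => mul_nonpos_of_nonneg_of_nonpos (hp l) (ho l)
  simp only [lagrangian, hb, optCost]
  linarith

/-- Strong duality, without constraint qualification: if the dual function is bounded by `M`, then
the dispatch problem is feasible with optimal cost at most `M`. -/
theorem exists_feasible_cost_le_of_forall_dualFun_le {e M : ℝ} {d : B → ℝ}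
    (h : ∀ p : ℝ × (L → ℝ), 0 ≤ p.2 → R.dualFun e d p ≤ M) :
    ∃ g ∈ R.feasible e d, R.cost g ≤ M := by
  by_contra hno
  rw [← R.mem_perturbationEpigraph_iff e e, sub_self, zero_smul] at hno
  obtain ⟨f, α, hfM, hf⟩ := geometric_hahn_banach_point_closed
    (R.convex_perturbationEpigraph e d) (R.isClosed_perturbationEpigraph e d) hno
  classical
  set τ : ℝ := f (1, 0, 0) with hτ
  set ν : ℝ := f (0, 1, 0) with hν
  set μ : L → ℝ := fun l => f (0, 0, Pi.single l 1) with hμ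
  have hfv : ∀ t s (u : L → ℝ), f (t, s, u) = τ * t + ν * s + μ ⬝ᵥ u := by
    intro t s u
    have h3 : f (0, 0, u) = μ ⬝ᵥ u := by
      have := LinearMap.pi_apply_eq_sum_univ
        ((f : ℝ × ℝ × (L → ℝ) →ₗ[ℝ] ℝ) ∘ₗ LinearMap.inr ℝ ℝ (ℝ × (L → ℝ)) ∘ₗ
          LinearMap.inr ℝ ℝ (L → ℝ)) u
      simp only [LinearMap.comp_apply, LinearMap.inr_apply, smul_eq_mul] at this
      refine (this.trans ?_)
      refine Finset.sum_congr rfl fun l _ => ?_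
      rw [mul_comm]
      congr 1
      simp only [hμ, ContinuousLinearMap.coe_coe]
      congr 3
      ext j
      simp [Pi.single_apply, eq_comm]
    have hdec : ((t, s, u) : ℝ × ℝ × (L → ℝ)) =
        t • (1, 0, 0) + s • (0, 1, 0) + (0, 0, u) := by simp
    rw [hdec, map_add, map_add, map_smul, map_smul, h3]
    simp only [smul_eq_mul]
    ring
  have hmem : ∀ g ∈ R.gen, ∀ t ≥ 0, ∀ u : L → ℝ, 0 ≤ u →
      α < τ * (R.cost g + t) + ν * balance e d g + μ ⬝ᵥ (R.overload e d g + u) := by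
    intro g hg t ht u hu
    rw [← hfv]
    exact hf _ ⟨g, hg, le_add_of_nonneg_right ht, rfl, le_add_of_nonneg_right hu⟩
  -- An affine function bounded below on a ray has nonnegative slope; this gives the signs of `τ`
  -- and `μ`.
  have hray : ∀ x y : ℝ, (∀ t ≥ (0 : ℝ), α < x + y * t) → 0 ≤ y := by
    intro x y hxy
    by_contra! hy
    have h1 := hxy ((|α - x| + 1) / -y) (by apply div_nonneg <;> [positivity; linarith])
    have h2 : y * ((|α - x| + 1) / -y) = -(|α - x| + 1) := by
      have : y ≠ 0 := hy.ne
      field_simp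
    linarith [neg_abs_le (α - x)]
  obtain ⟨g₀, hg₀⟩ := R.gen_nonempty
  have hτ0 : 0 ≤ τ := by
    refine hray (τ * R.cost g₀ + ν * balance e d g₀ + μ ⬝ᵥ R.overload e d g₀) τ fun t ht => ?_
    have := hmem g₀ hg₀ t ht 0 le_rfl
    rw [add_zero] at this
    linarith
  have hμ0 : 0 ≤ μ := by
    intro l
    refine hray (τ * R.cost g₀ + ν * balance e d g₀ + μ ⬝ᵥ R.overload e d g₀) _ fun t ht => ?_
    have := hmem g₀ hg₀ 0 le_rfl (Pi.single l t) (Pi.single_nonneg.2 ht)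
    rw [dotProduct_add, dotProduct_single] at this
    linarith
  rw [hfv, dotProduct_zero] at hfM
  have hsep : ∀ g ∈ R.gen, α < τ * R.cost g + ν * balance e d g + μ ⬝ᵥ R.overload e d g := by
    intro g hg
    simpa using hmem g hg 0 le_rfl 0 le_rfl
  rcases hτ0.eq_or_lt with hz | hpos
  -- Vertical hyperplane: large multiples of `(ν, μ)` drive the dual function to infinity; `k` is
  -- chosen so that `-κ + k * α` exceeds `M`.
  · obtain ⟨c, hc, κ, hκ⟩ := R.exists_mul_sq_norm_sub_le_cost
    have hα : 0 < α := by simpa [← hz] using hfM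
    set k : ℝ := (|M + κ| + 1) / α with hk
    have hk0 : 0 < k := by positivity
    have hkα : k * α = |M + κ| + 1 := div_mul_cancel₀ _ hα.ne'
    have h1 := h (k * ν, k • μ) (smul_nonneg hk0.le hμ0)
    have h2 : -κ + k * α ≤ R.dualFun e d (k * ν, k • μ) := by
      refine R.le_dualFun fun g hg => ?_
      have h3 := hsep g hg
      have h4 : 0 ≤ c * ‖g‖ ^ 2 := by positivity
      have h5 := hκ g
      rw [← hz, zero_mul, zero_add] at h3
      have h6 := mul_le_mul_of_nonneg_left h3.le hk0.le
      simp only [lagrangian, smul_dotProduct, smul_eq_mul]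
      linarith
    linarith [le_abs_self (M + κ)]
  -- Normalizing the cost coefficient to 1 turns the hyperplane into multipliers with dual value
  -- above `M`.
  · have h1 := h (τ⁻¹ * ν, τ⁻¹ • μ) (smul_nonneg (by positivity) hμ0)
    have h2 : τ⁻¹ * α ≤ R.dualFun e d (τ⁻¹ * ν, τ⁻¹ • μ) := by
      refine R.le_dualFun fun g hg => ?_
      have h6 := mul_le_mul_of_nonneg_left (hsep g hg).le (inv_nonneg.2 hτ0)
      have h7 : τ⁻¹ * (τ * R.cost g) = R.cost g := inv_mul_cancel_left₀ hpos.ne' _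
      simp only [lagrangian, smul_dotProduct, smul_eq_mul]
      linarith
    have h3 : M < τ⁻¹ * α := by
      rw [inv_mul_eq_div, lt_div_iff₀ hpos]
      linarith
    linarith

/-- If the optimal dual solution is unique, then the optimal cost is differentiable in the net
export and its derivative is the proxy bus price. -/
theorem hasDerivAt_optCost {e : ℝ} {d : B → ℝ} (hfe : ∀ᶠ x in 𝓝 e, (R.feasible x d).Nonempty)
    (hu : ∃! p, R.IsOptimalDual e d p) :
    HasDerivAt (fun x => R.optCost x d) (R.price e d) e := by
  have hp : R.IsOptimalDual e d (R.optDual e d) := Classical.epsilon_spec hu.exists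
  have hprice : R.price e d = R.proxyPrice (R.optDual e d) := rfl
  set p₀ := R.optDual e d with hp₀
  set K : Set (ℝ × (L → ℝ)) := {p | 0 ≤ p.2} with hK
  have hKc : IsClosed K := isClosed_le continuous_const continuous_snd
  have hKconv : Convex ℝ K := by
    intro x hx y hy a b ha hb _
    have hx' : 0 ≤ x.2 := hx
    have hy' : 0 ≤ y.2 := hy
    exact add_nonneg (smul_nonneg ha hx') (smul_nonneg hb hy')
  have hmax : ∀ p ∈ K, p ≠ p₀ → R.dualFun e d p < R.dualFun e d p₀ := by
    intro p hpK hne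
    refine lt_of_le_of_ne (hp.2 p hpK) fun heq => hne ?_
    refine hu.unique ⟨hpK, fun p' hp' => ?_⟩ hp
    rw [heq]
    exact hp.2 p' hp'
  have hval : R.optCost e d = R.dualFun e d p₀ :=
    le_antisymm (R.exists_feasible_cost_le_iff.1
      (R.exists_feasible_cost_le_of_forall_dualFun_le hp.2)).2
      (R.dualFun_le_optCost hfe.self_of_nhds hp.1)
  rw [hprice, hasDerivAt_iff_isLittleO, Asymptotics.isLittleO_iff]
  intro ε hε
  obtain ⟨δ, hδ, hpert⟩ := exists_perturbed_le_of_unique_isMaxOn hKc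
    ((R.concaveOn_dualFun e d).subset (subset_univ _) hKconv)
    ((R.upperSemicontinuous_dualFun e d).upperSemicontinuousOn K) hp.1 hmax R.proxyPrice hε
  filter_upwards [hfe, Metric.closedBall_mem_nhds e hδ] with x hx hxδ
  -- Weak duality at the old multiplier `p₀` bounds the new cost below by the tangent; strong
  -- duality for the perturbed dual bounds it above within `ε * |x - e|`.
  have h1 : R.dualFun e d p₀ + (x - e) * R.proxyPrice p₀ ≤ R.optCost x d := by
    rw [← dualFun_eq_add]
    exact R.dualFun_le_optCost hx hp.1
  have h2 : R.optCost x d ≤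
      R.dualFun e d p₀ + (x - e) * R.proxyPrice p₀ + ε * |x - e| := by
    refine (R.exists_feasible_cost_le_iff.1
      (R.exists_feasible_cost_le_of_forall_dualFun_le fun p hpK => ?_)).2
    rw [R.dualFun_eq_add x e]
    exact hpert _ hxδ p hpK
  rw [hval, Real.norm_eq_abs, Real.norm_eq_abs, smul_eq_mul, abs_of_nonneg (by linarith)]
  linarith

end Region

/-! ### Convex functions of one real variable. -/

/-- A strictly convex function on `A ⊆ ℝ` whose sublevel sets are closed in `ℝ` and bounded has a
unique minimizer. -/
theorem StrictConvexOn.exists_unique_isMinOn_real {A : Set ℝ} {W : ℝ → ℝ}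
    (hW : StrictConvexOn ℝ A W) (hne : A.Nonempty)
    (hcl : ∀ t, IsClosed {q | q ∈ A ∧ W q ≤ t})
    (hbd : ∀ t, Bornology.IsBounded {q | q ∈ A ∧ W q ≤ t}) :
    ∃ qs, ∀ q, (q ∈ A ∧ IsMinOn W A q) ↔ q = qs := by
  obtain ⟨q₀, hq₀⟩ := hne
  set S := {q | q ∈ A ∧ W q ≤ W q₀} with hS
  have hSc : IsCompact S := Metric.isCompact_of_isClosed_isBounded (hcl _) (hbd _)
  have hlsc : LowerSemicontinuousOn W S := by
    intro q _ t ht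
    by_contra hfr
    have hfr : ∃ᶠ x in 𝓝[S] q, x ∈ {q | q ∈ A ∧ W q ≤ t} :=
      ((not_eventually.1 hfr).and_eventually eventually_mem_nhdsWithin).mono
        fun x hx => ⟨hx.2.1, not_lt.1 hx.1⟩
    have hm := (hcl t).mem_of_frequently_of_tendsto hfr (tendsto_id.mono_left nhdsWithin_le_nhds)
    exact absurd hm.2 (not_le.2 ht)
  have hSn : S.Nonempty := ⟨q₀, hq₀, le_refl (W q₀)⟩
  obtain ⟨qs, hqs, hmin⟩ := LowerSemicontinuousOn.exists_isMinOn hSn hSc hlsc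
  have hmin' : IsMinOn W A qs := by
    intro x hx
    by_cases h : W x ≤ W q₀
    · exact hmin ⟨hx, h⟩
    · exact hqs.2.trans (not_le.1 h).le
  refine ⟨qs, fun q => ⟨fun ⟨hq, hm⟩ => hW.eq_of_isMinOn hm hmin' hq hqs.1, ?_⟩⟩
  rintro rfl
  exact ⟨hqs.1, hmin'⟩

/-- A convex function on a compact interval that is lower semicontinuous at the end points and
differentiable inside is the integral of its derivative. -/
theorem ConvexOn.intervalIntegrable_deriv_and_integral_eq {W w : ℝ → ℝ} {x y : ℝ} (hxy : x ≤ y)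
    (hW : ConvexOn ℝ (Icc x y) W) (hcl : ∀ t, IsClosed {q | q ∈ Icc x y ∧ W q ≤ t})
    (hderiv : ∀ q ∈ Ioo x y, HasDerivAt W (w q) q) :
    IntervalIntegrable w volume x y ∧ ∫ q in x..y, w q = W y - W x := by
  rcases hxy.eq_or_lt with rfl | hlt
  · simp
  have hchord : ∀ z ∈ Icc x y, W z ≤ (y - z) / (y - x) * W x + (z - x) / (y - x) * W y := by
    intro z hz
    have hd : 0 < y - x := sub_pos.2 hlt
    have := hW.2 (left_mem_Icc.2 hxy) (right_mem_Icc.2 hxy)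
      (div_nonneg (sub_nonneg.2 hz.2) hd.le) (div_nonneg (sub_nonneg.2 hz.1) hd.le)
      (by field_simp; ring)
    have hz' : ((y - z) / (y - x)) • x + ((z - x) / (y - x)) • y = z := by
      simp only [smul_eq_mul]
      field_simp
      ring
    rwa [hz'] at this
  have hlsc : ∀ q ∈ Icc x y, ∀ t < W q, ∀ᶠ z in 𝓝[Icc x y] q, t < W z := by
    intro q hq t ht
    by_contra hfr
    have hfr : ∃ᶠ z in 𝓝[Icc x y] q, z ∈ {q | q ∈ Icc x y ∧ W q ≤ t} :=
      ((not_eventually.1 hfr).and_eventually eventually_mem_nhdsWithin).mono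
        fun z hz => ⟨hz.2, not_lt.1 hz.1⟩
    have hm := (hcl t).mem_of_frequently_of_tendsto hfr (tendsto_id.mono_left nhdsWithin_le_nhds)
    exact absurd hm.2 (not_le.2 ht)
  -- At an end point the chord takes the value of `W`, so it supplies the upper half of continuity;
  -- closed sublevel sets supply the lower half.
  have hend : ∀ q ∈ Icc x y, (y - q) / (y - x) * W x + (q - x) / (y - x) * W y = W q →
      ContinuousWithinAt W (Icc x y) q := by
    intro q hq hqv
    refine tendsto_order.2 ⟨hlsc q hq, fun t ht => ?_⟩
    have hc : Continuous fun z => (y - z) / (y - x) * W x + (z - x) / (y - x) * W y := by fun_prop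
    have := (hc.tendsto q).eventually (gt_mem_nhds (hqv.trans_lt ht))
    filter_upwards [mem_nhdsWithin_of_mem_nhds this, self_mem_nhdsWithin] with z hz hzm
    exact (hchord z hzm).trans_lt hz
  have hd : y - x ≠ 0 := (sub_pos.2 hlt).ne'
  have hcont : ContinuousOn W (Icc x y) := by
    intro q hq
    rcases eq_endpoints_or_mem_Ioo_of_mem_Icc hq with rfl | rfl | hq'
    · exact hend _ hq (by simp [div_self hd])
    · exact hend _ hq (by simp [div_self hd])
    · exact (hderiv q hq').continuousAt.continuousWithinAt
  have hmono : ∀ p ∈ Ioo x y, ∀ q ∈ Ioo x y, p ≤ q → w p ≤ w q := by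
    intro p hp q hq hpq
    have := (hW.subset Ioo_subset_Icc_self (convex_Ioo x y)).monotoneOn_deriv
      (fun z hz => (hderiv z hz).differentiableAt) hp hq hpq
    rwa [(hderiv p hp).deriv, (hderiv q hq).deriv] at this
  -- The monotone `w` may be unbounded near both ends. After subtracting `w c` it has a constant
  -- sign on each side of `c`, where integrability of a signed derivative applies.
  have hint : IntervalIntegrable w volume x y := by
    obtain ⟨c, hc⟩ := nonempty_Ioo.2 hlt
    have hcc : IntervalIntegrable (fun _ : ℝ => w c) volume x y := intervalIntegrable_const
    have h2 : IntervalIntegrable (fun q => w q - w c) volume c y := by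
      refine intervalIntegral.intervalIntegrable_deriv_of_nonneg (g := fun q => W q - w c * q)
        ?_ ?_ ?_
      · rw [uIcc_of_le hc.2.le]
        exact (hcont.mono (Icc_subset_Icc_left hc.1.le)).sub (by fun_prop)
      · rw [min_eq_left hc.2.le, max_eq_right hc.2.le]
        intro q hq
        simpa using (hderiv q ⟨hc.1.trans hq.1, hq.2⟩).fun_sub ((hasDerivAt_id q).const_mul (w c))
      · rw [min_eq_left hc.2.le, max_eq_right hc.2.le]
        intro q hq
        exact sub_nonneg.2 (hmono c hc q ⟨hc.1.trans hq.1, hq.2⟩ hq.1.le)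
    have h1 : IntervalIntegrable (fun q => w c - w q) volume x c := by
      refine intervalIntegral.intervalIntegrable_deriv_of_nonneg (g := fun q => w c * q - W q)
        ?_ ?_ ?_
      · rw [uIcc_of_le hc.1.le]
        exact ContinuousOn.sub (by fun_prop) (hcont.mono (Icc_subset_Icc_right hc.2.le))
      · rw [min_eq_left hc.1.le, max_eq_right hc.1.le]
        intro q hq
        simpa using ((hasDerivAt_id q).const_mul (w c)).fun_sub (hderiv q ⟨hq.1, hq.2.trans hc.2⟩)
      · rw [min_eq_left hc.1.le, max_eq_right hc.1.le]
        intro q hq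
        exact sub_nonneg.2 (hmono q ⟨hq.1, hq.2.trans hc.2⟩ c hc hq.2.le)
    have h1' : IntervalIntegrable w volume x c := by
      simpa using (intervalIntegrable_const (c := w c)).sub h1
    have h2' : IntervalIntegrable w volume c y := by
      simpa using h2.add (intervalIntegrable_const (c := w c))
    exact h1'.trans h2'
  exact ⟨hint, intervalIntegral.integral_eq_sub_of_hasDerivAt_of_le hxy hcont hderiv hint⟩

/-- At an interior point, a differentiable convex function is minimal iff its derivative
vanishes. -/
theorem ConvexOn.isMinOn_iff_deriv_eq_zero {A : Set ℝ} {W : ℝ → ℝ} {w q : ℝ}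
    (hW : ConvexOn ℝ A W) (hq : q ∈ interior A) (hderiv : HasDerivAt W w q) :
    IsMinOn W A q ↔ w = 0 := by
  constructor
  · intro hm
    exact (hm.isLocalMin (mem_interior_iff_mem_nhds.1 hq)).hasDerivAt_eq_zero hderiv
  · rintro rfl
    exact hW.isMinOn_of_rightDeriv_eq_zero hq
      (hderiv.hasDerivWithinAt.derivWithin (uniqueDiffWithinAt_Ioi q))

theorem StrictConvexOn.comp_neg_real {s : Set ℝ} {f : ℝ → ℝ} (hf : StrictConvexOn ℝ s f) :
    StrictConvexOn ℝ {q | -q ∈ s} fun q => f (-q) := by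
  have hneg : ∀ a b x y : ℝ, -(a • x + b • y) = a • (-x) + b • (-y) := by
    intro a b x y
    simp only [smul_eq_mul]
    ring
  refine ⟨fun x hx y hy a b ha hb hab => ?_, fun x hx y hy hxy a b ha hb hab => ?_⟩
  · show -(a • x + b • y) ∈ s
    rw [hneg]
    exact hf.1 hx hy ha hb hab
  · simp only [hneg]
    exact hf.2 hx hy (neg_injective.ne hxy) ha hb hab

/-! ### The two-region system: pathwise and expected cost. -/

namespace TwoRegionSystem

variable {B₁ L₁ B₂ L₂ : Type*} [Fintype B₁] [Fintype L₁] [Fintype B₂] [Fintype L₂]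
  (T : TwoRegionSystem B₁ L₁ B₂ L₂)

/-- The interchanges at which both regional dispatch problems are feasible. -/
def dispatchable (x₁ : B₁ → ℝ) (x₂ : B₂ → ℝ) : Set ℝ :=
  {q | (T.R₁.feasible q x₁).Nonempty ∧ (T.R₂.feasible (-q) x₂).Nonempty}

theorem strictConvexOn_cost₁ (x₁ : B₁ → ℝ) (x₂ : B₂ → ℝ) :
    StrictConvexOn ℝ (T.dispatchable x₁ x₂) fun q => T.cost₁ q x₁ := by
  have h := T.R₁.strictConvexOn_optCost x₁
  have h' := (T.R₂.strictConvexOn_optCost x₂).comp_neg_real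
  exact h.subset (fun q hq => hq.1) (h.1.inter h'.1)

theorem strictConvexOn_cost₂ (x₁ : B₁ → ℝ) (x₂ : B₂ → ℝ) :
    StrictConvexOn ℝ (T.dispatchable x₁ x₂) fun q => T.cost₂ q x₂ := by
  have h := T.R₁.strictConvexOn_optCost x₁
  have h' := (T.R₂.strictConvexOn_optCost x₂).comp_neg_real
  exact h'.subset (fun q hq => hq.2) (h.1.inter h'.1)

theorem exists_forall_le_cost : ∃ κ, ∀ q x₁ x₂, κ ≤ T.cost₁ q x₁ + T.cost₂ q x₂ := by
  obtain ⟨κ₁, h₁⟩ := T.R₁.exists_forall_le_optCost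
  obtain ⟨κ₂, h₂⟩ := T.R₂.exists_forall_le_optCost
  exact ⟨κ₁ + κ₂, fun q x₁ x₂ => add_le_add (h₁ _ _) (h₂ _ _)⟩

/-- Region 1 alone confines `q`, since the cost of region 2 is bounded below. -/
theorem isBounded_cost_le (x₁ : B₁ → ℝ) (x₂ : B₂ → ℝ) (t : ℝ) :
    Bornology.IsBounded {q | q ∈ T.dispatchable x₁ x₂ ∧ T.cost₁ q x₁ + T.cost₂ q x₂ ≤ t} := by
  obtain ⟨κ₂, h₂⟩ := T.R₂.exists_forall_le_optCost
  refine (T.R₁.isBounded_optCost_le x₁ (t - κ₂)).subset fun q hq => ⟨hq.1.1, ?_⟩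
  have h1 : T.R₁.optCost q x₁ + T.R₂.optCost (-q) x₂ ≤ t := hq.2
  linarith [h₂ (-q) x₂]

/-- The uniform lower bounds trap the cost of region 1 in a compact interval. A subsequential limit
`s` splits the budget into `s` and `z₀.2 - s`, and each regional epigraph is closed. -/
theorem isClosed_epigraph (x₁ : B₁ → ℝ) (x₂ : B₂ → ℝ) :
    IsClosed {z : ℝ × ℝ |
      z.1 ∈ T.dispatchable x₁ x₂ ∧ T.cost₁ z.1 x₁ + T.cost₂ z.1 x₂ ≤ z.2} := by
  obtain ⟨κ₁, h₁⟩ := T.R₁.exists_forall_le_optCost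
  obtain ⟨κ₂, h₂⟩ := T.R₂.exists_forall_le_optCost
  refine IsSeqClosed.isClosed fun z z₀ hz hlim => ?_
  have hl1 : Tendsto (fun n => (z n).1) atTop (𝓝 z₀.1) := (continuous_fst.tendsto _).comp hlim
  have hl2 : Tendsto (fun n => (z n).2) atTop (𝓝 z₀.2) := (continuous_snd.tendsto _).comp hlim
  obtain ⟨M, hM⟩ := hl2.bddAbove_range
  have hsum : ∀ n, T.R₁.optCost (z n).1 x₁ + T.R₂.optCost (-(z n).1) x₂ ≤ (z n).2 :=
    fun n => (hz n).2
  obtain ⟨s, -, u, hu, hs⟩ := tendsto_subseq_of_bounded (Metric.isBounded_Icc κ₁ (M - κ₂))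
    (x := fun n => T.R₁.optCost (z n).1 x₁) fun n => ⟨h₁ _ _, by
      have := hM (mem_range_self n)
      linarith [h₂ (-(z n).1) x₂, hsum n]⟩
  have hl1' := hl1.comp hu.tendsto_atTop
  have hl2' := hl2.comp hu.tendsto_atTop
  have m1 := (T.R₁.isClosed_epigraph x₁).mem_of_tendsto (hl1'.prodMk_nhds hs)
    (Eventually.of_forall fun n => T.R₁.exists_feasible_cost_le_iff.2 ⟨(hz (u n)).1.1, le_rfl⟩)
  have m2 := (T.R₂.isClosed_epigraph x₂).mem_of_tendsto (hl1'.neg.prodMk_nhds (hl2'.sub hs))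
    (Eventually.of_forall fun n => T.R₂.exists_feasible_cost_le_iff.2 ⟨(hz (u n)).1.2, by
      have := hsum (u n)
      simp only [Function.comp_apply]
      linarith⟩)
  have m1' := T.R₁.exists_feasible_cost_le_iff.1 m1
  have m2' := T.R₂.exists_feasible_cost_le_iff.1 m2
  refine ⟨⟨m1'.1, m2'.1⟩, ?_⟩
  have e1 : T.R₁.optCost z₀.1 x₁ ≤ s := m1'.2
  have e2 : T.R₂.optCost (-z₀.1) x₂ ≤ z₀.2 - s := m2'.2
  simp only [cost₁, cost₂]
  linarith

section

variable {Ω : Type*} [MeasurableSpace Ω] {P : Measure Ω} {d₁ : Ω → B₁ → ℝ} {d₂ : Ω → B₂ → ℝ}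

theorem convex_admissible : Convex ℝ (T.admissible P d₁ d₂) := by
  intro x hx y hy a b ha hb hab
  refine ⟨convex_Iic T.Q hx.1 hy.1 ha hb hab, ?_⟩
  filter_upwards [hx.2, hy.2] with ω h h'
  exact (T.strictConvexOn_cost₁ (d₁ ω) (d₂ ω)).1 h h' ha hb hab

/-- Fatou along a sequence of interchanges; countability lets one null set handle feasibility for
all of them. Both closedness and boundedness of the sublevel sets rest on this. -/
theorem exists_integrable_forall_frequently_cost_lt [IsProbabilityMeasure P]
    (hc : ∀ q ∈ T.admissible P d₁ d₂,
      Integrable (fun ω => T.cost₁ q (d₁ ω) + T.cost₂ q (d₂ ω)) P)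
    {q : ℕ → ℝ} {M : ℝ} (hq : ∀ n, q n ∈ T.admissible P d₁ d₂)
    (hM : ∀ n, T.expectedCost P d₁ d₂ (q n) ≤ M) :
    ∃ F : Ω → ℝ, Integrable F P ∧ ∫ ω, F ω ∂P ≤ M ∧
      ∀ᵐ ω ∂P, ∀ t, F ω < t → ∃ᶠ n in atTop, q n ∈ T.dispatchable (d₁ ω) (d₂ ω) ∧
        T.cost₁ (q n) (d₁ ω) + T.cost₂ (q n) (d₂ ω) ≤ t := by
  obtain ⟨κ, hκ⟩ := T.exists_forall_le_cost
  obtain ⟨F, hFi, hFM, hF⟩ := exists_integrable_forall_frequently_lt (fun n => hc _ (hq n))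
    (fun n => Eventually.of_forall fun ω => hκ _ _ _) hM
  refine ⟨F, hFi, hFM, ?_⟩
  filter_upwards [hF, ae_all_iff.2 fun n => (hq n).2] with ω h h' t ht
  exact (h t ht).mono fun n hn => ⟨h' n, hn.le⟩

/-- Closed pathwise epigraphs carry feasibility as well as the bound by `F` to the limit, so
admissibility of `q₀` comes out before its expected cost is used. -/
theorem isClosed_expectedCost_le [IsProbabilityMeasure P]
    (hc : ∀ q ∈ T.admissible P d₁ d₂,
      Integrable (fun ω => T.cost₁ q (d₁ ω) + T.cost₂ q (d₂ ω)) P) (t : ℝ) :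
    IsClosed {q | q ∈ T.admissible P d₁ d₂ ∧ T.expectedCost P d₁ d₂ q ≤ t} := by
  refine IsSeqClosed.isClosed fun q q₀ hq hlim => ?_
  obtain ⟨F, hFi, hFM, hF⟩ := T.exists_integrable_forall_frequently_cost_lt hc
    (fun n => (hq n).1) (fun n => (hq n).2)
  have hepi : ∀ᵐ ω ∂P, ∀ t, F ω < t → q₀ ∈ T.dispatchable (d₁ ω) (d₂ ω) ∧
      T.cost₁ q₀ (d₁ ω) + T.cost₂ q₀ (d₂ ω) ≤ t := by
    filter_upwards [hF] with ω h t ht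
    exact (T.isClosed_epigraph (d₁ ω) (d₂ ω)).mem_of_frequently_of_tendsto (h t ht)
      (hlim.prodMk_nhds tendsto_const_nhds)
  have hmem : q₀ ∈ T.admissible P d₁ d₂ :=
    ⟨le_of_tendsto' hlim fun n => (hq n).1.1, hepi.mono fun ω h => (h (F ω + 1) (by linarith)).1⟩
  refine ⟨hmem, le_trans (integral_mono_ae (hc _ hmem) hFi ?_) hFM⟩
  exact hepi.mono fun ω h => le_of_forall_gt_imp_ge_of_dense fun t ht => (h t ht).2

/-- Along an unbounded sequence, a single scenario `ω` would return infinitely often to a pathwise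
sublevel set, which is bounded. -/
theorem isBounded_expectedCost_le [IsProbabilityMeasure P]
    (hc : ∀ q ∈ T.admissible P d₁ d₂,
      Integrable (fun ω => T.cost₁ q (d₁ ω) + T.cost₂ q (d₂ ω)) P) (t : ℝ) :
    Bornology.IsBounded {q | q ∈ T.admissible P d₁ d₂ ∧ T.expectedCost P d₁ d₂ q ≤ t} := by
  by_contra hno
  have hunb : ∀ n : ℕ, ∃ q, (q ∈ T.admissible P d₁ d₂ ∧ T.expectedCost P d₁ d₂ q ≤ t) ∧
      (n : ℝ) < ‖q‖ := by
    intro n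
    by_contra! h
    exact hno (isBounded_iff_forall_norm_le.2 ⟨n, fun q hq => h q hq⟩)
  choose q hq hqn using hunb
  obtain ⟨F, -, -, hF⟩ := T.exists_integrable_forall_frequently_cost_lt hc
    (fun n => (hq n).1) (fun n => (hq n).2)
  obtain ⟨ω, hω⟩ := hF.exists
  obtain ⟨C, hC⟩ := isBounded_iff_forall_norm_le.1
    (T.isBounded_cost_le (d₁ ω) (d₂ ω) (F ω + 1))
  obtain ⟨N, hN⟩ := exists_nat_ge C
  obtain ⟨n, hn, hnN⟩ := ((hω _ (lt_add_one _)).and_eventually (eventually_ge_atTop N)).exists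
  have h1 := hC _ hn
  have h2 : (N : ℝ) ≤ n := by exact_mod_cast hnN
  linarith [hqn n]

theorem strictConvexOn_expectedCost [IsProbabilityMeasure P]
    (hc : ∀ q ∈ T.admissible P d₁ d₂,
      Integrable (fun ω => T.cost₁ q (d₁ ω) + T.cost₂ q (d₂ ω)) P) :
    StrictConvexOn ℝ (T.admissible P d₁ d₂) (T.expectedCost P d₁ d₂) := by
  refine ⟨T.convex_admissible, fun x hx y hy hxy a b ha hb hab => ?_⟩
  have hz := T.convex_admissible hx hy ha.le hb.le hab
  have hlt : ∀ᵐ ω ∂P, 0 < (a * (T.cost₁ x (d₁ ω) + T.cost₂ x (d₂ ω)) +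
      b * (T.cost₁ y (d₁ ω) + T.cost₂ y (d₂ ω))) -
      (T.cost₁ (a • x + b • y) (d₁ ω) + T.cost₂ (a • x + b • y) (d₂ ω)) := by
    filter_upwards [hx.2, hy.2] with ω h h'
    exact sub_pos.2 (((T.strictConvexOn_cost₁ (d₁ ω) (d₂ ω)).add
      (T.strictConvexOn_cost₂ (d₁ ω) (d₂ ω))).2 h h' hxy ha hb hab)
  have hi' : Integrable (fun ω => a * (T.cost₁ x (d₁ ω) + T.cost₂ x (d₂ ω)) +
      b * (T.cost₁ y (d₁ ω) + T.cost₂ y (d₂ ω))) P :=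
    ((hc x hx).const_mul a).add ((hc y hy).const_mul b)
  have hi := hi'.sub (hc _ hz)
  have hpos := (integral_pos_iff_support_of_nonneg_ae (hlt.mono fun ω h => h.le) hi).2 (by
    rw [pos_iff_ne_zero]
    intro h0
    obtain ⟨ω, h1, h2⟩ := (hlt.and (measure_eq_zero_iff_ae_notMem.1 h0)).exists
    exact h2 h1.ne')
  rw [integral_sub hi' (hc _ hz),
    integral_add ((hc x hx).const_mul a) ((hc y hy).const_mul b), integral_const_mul,
    integral_const_mul] at hpos
  exact sub_pos.1 hpos

theorem hasDerivAt_expectedCost [IsProbabilityMeasure P]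
    (hc₁ : ∀ q ∈ T.admissible P d₁ d₂, Integrable (fun ω => T.cost₁ q (d₁ ω)) P)
    (hc₂ : ∀ q ∈ T.admissible P d₁ d₂, Integrable (fun ω => T.cost₂ q (d₂ ω)) P)
    {q : ℝ} (hq : q ∈ interior (T.admissible P d₁ d₂))
    (hu₁ : ∀ᵐ ω ∂P, ∃! p, T.R₁.IsOptimalDual q (d₁ ω) p)
    (hu₂ : ∀ᵐ ω ∂P, ∃! p, T.R₂.IsOptimalDual (-q) (d₂ ω) p) :
    (Integrable (fun ω => T.price₁ q (d₁ ω)) P ∧ Integrable (fun ω => T.price₂ q (d₂ ω)) P) ∧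
      HasDerivAt (T.expectedCost P d₁ d₂)
        (T.expectedPrice₁ P d₁ q - T.expectedPrice₂ P d₂ q) q := by
  obtain ⟨δ, hδ, hsub⟩ := Metric.nhds_basis_closedBall.mem_iff.1 (mem_interior_iff_mem_nhds.1 hq)
  rw [Real.closedBall_eq_Icc] at hsub
  have hIcc : Icc (q - δ) (q + δ) ∈ 𝓝 q := Icc_mem_nhds (by linarith) (by linarith)
  -- Almost sure feasibility at the two end points suffices: pathwise convexity fills the interval,
  -- avoiding an uncountable union of null sets.
  have hdis : ∀ᵐ ω ∂P, Icc (q - δ) (q + δ) ⊆ T.dispatchable (d₁ ω) (d₂ ω) := by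
    filter_upwards [(hsub (left_mem_Icc.2 (by linarith))).2,
      (hsub (right_mem_Icc.2 (by linarith))).2] with ω h h'
    exact (T.strictConvexOn_cost₁ (d₁ ω) (d₂ ω)).1.ordConnected.out h h'
  have r₁ := hasDerivAt_integral_of_ae_convexOn (P := P) (f := fun x ω => T.cost₁ x (d₁ ω))
    (f' := fun ω => T.price₁ q (d₁ ω)) hδ
    (hdis.mono fun ω h =>
      (T.strictConvexOn_cost₁ (d₁ ω) (d₂ ω)).convexOn.subset h (convex_Icc _ _))
    (fun x hx => hc₁ x (hsub hx)) (by
      filter_upwards [hdis, hu₁] with ω h hu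
      exact T.R₁.hasDerivAt_optCost (mem_of_superset hIcc fun x hx => (h hx).1) hu)
  have r₂ := hasDerivAt_integral_of_ae_convexOn (P := P) (f := fun x ω => T.cost₂ x (d₂ ω))
    (f' := fun ω => -T.price₂ q (d₂ ω)) hδ
    (hdis.mono fun ω h =>
      (T.strictConvexOn_cost₂ (d₁ ω) (d₂ ω)).convexOn.subset h (convex_Icc _ _))
    (fun x hx => hc₂ x (hsub hx)) (by
      filter_upwards [hdis, hu₂] with ω h hu
      have hfe : ∀ᶠ x in 𝓝 (-q), (T.R₂.feasible x (d₂ ω)).Nonempty := by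
        have : Tendsto (fun x : ℝ => -x) (𝓝 (-q)) (𝓝 q) := by
          simpa using (continuous_neg (G := ℝ)).tendsto (-q)
        filter_upwards [this hIcc] with x hx
        simpa using (h hx).2
      have := (T.R₂.hasDerivAt_optCost hfe hu).comp q (hasDerivAt_neg q)
      rw [mul_neg_one] at this
      exact this)
  refine ⟨⟨r₁.1, by simpa using r₂.1.neg⟩, ?_⟩
  have hadd := r₁.2.add r₂.2
  rw [integral_neg, ← sub_eq_add_neg] at hadd
  refine hadd.congr_of_eventuallyEq ?_
  filter_upwards [hIcc] with x hx
  exact integral_add (hc₁ x (hsub hx)) (hc₂ x (hsub hx))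

end

end TwoRegionSystem

/-! ### Welfare as cost reduction, and the conclusion. -/

namespace TwoRegionSystem

/-- The welfare is the reduction of the expected cost with respect to zero interchange. -/
theorem intervalIntegrable_and_welfare_eq {B₁ L₁ B₂ L₂ : Type*} [Fintype B₁] [Fintype L₁]
    [Fintype B₂] [Fintype L₂] (T : TwoRegionSystem B₁ L₁ B₂ L₂) {Ω : Type*} [MeasurableSpace Ω]
    {P : Measure Ω} {d₁ : Ω → B₁ → ℝ} {d₂ : Ω → B₂ → ℝ} [IsProbabilityMeasure P]
    (hc : ∀ q ∈ T.admissible P d₁ d₂,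
      Integrable (fun ω => T.cost₁ q (d₁ ω) + T.cost₂ q (d₂ ω)) P)
    (hderiv : ∀ q ∈ interior (T.admissible P d₁ d₂), HasDerivAt (T.expectedCost P d₁ d₂)
      (T.expectedPrice₁ P d₁ q - T.expectedPrice₂ P d₂ q) q)
    (h0 : (0 : ℝ) ∈ T.admissible P d₁ d₂) {q : ℝ} (hq : q ∈ T.admissible P d₁ d₂) :
    IntervalIntegrable (fun x => T.expectedPrice₂ P d₂ x - T.expectedPrice₁ P d₁ x) volume 0 q ∧
      T.welfare P d₁ d₂ q = T.expectedCost P d₁ d₂ 0 - T.expectedCost P d₁ d₂ q := by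
  have key : ∀ x ∈ T.admissible P d₁ d₂, ∀ y ∈ T.admissible P d₁ d₂, x ≤ y →
      IntervalIntegrable (fun x => T.expectedPrice₁ P d₁ x - T.expectedPrice₂ P d₂ x)
        volume x y ∧ ∫ z in x..y, (T.expectedPrice₁ P d₁ z - T.expectedPrice₂ P d₂ z) =
          T.expectedCost P d₁ d₂ y - T.expectedCost P d₁ d₂ x := by
    intro x hx y hy hxy
    have hsub : Icc x y ⊆ T.admissible P d₁ d₂ := T.convex_admissible.ordConnected.out hx hy
    refine ConvexOn.intervalIntegrable_deriv_and_integral_eq hxy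
      ((T.strictConvexOn_expectedCost hc).convexOn.subset hsub (convex_Icc _ _)) (fun t => ?_)
      -- Only the open interval is certain to lie in the interior; `x` and `y` may be boundary
      -- points of the admissible set.
      fun z hz => hderiv z (interior_maximal (Ioo_subset_Icc_self.trans hsub) isOpen_Ioo hz)
    convert! isClosed_Icc.inter (T.isClosed_expectedCost_le hc t) using 1
    ext z
    exact ⟨fun h => ⟨h.1, hsub h.1, h.2⟩, fun h => ⟨h.1, h.2.2⟩⟩
  have hneg : (fun x => T.expectedPrice₂ P d₂ x - T.expectedPrice₁ P d₁ x) =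
      fun x => -(T.expectedPrice₁ P d₁ x - T.expectedPrice₂ P d₂ x) := by
    ext x
    ring
  rw [welfare, hneg, intervalIntegral.integral_neg]
  rcases le_total 0 q with h | h
  · obtain ⟨hi, he⟩ := key 0 h0 q hq h
    exact ⟨hi.neg, by rw [he]; ring⟩
  · obtain ⟨hi, he⟩ := key q hq 0 h0 h
    exact ⟨hi.symm.neg, by rw [intervalIntegral.integral_symm, he]; ring⟩

end TwoRegionSystem

end

theorem theorem1 {B₁ L₁ B₂ L₂ : Type*} [Fintype B₁] [Fintype L₁] [Fintype B₂] [Fintype L₂]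
    (T : TwoRegionSystem B₁ L₁ B₂ L₂)
    {Ω : Type*} [MeasurableSpace Ω] (P : Measure Ω) [IsProbabilityMeasure P]
    (d₁ : Ω → B₁ → ℝ) (d₂ : Ω → B₂ → ℝ) (hd₁ : Measurable d₁) (hd₂ : Measurable d₂)
    -- zero interchange, the base point of the welfare integral, is admissible
    (h0 : (0 : ℝ) ∈ T.admissible P d₁ d₂)
    -- the expected generation costs are finite
    (hc₁ : ∀ q ∈ T.admissible P d₁ d₂, Integrable (fun ω => T.cost₁ q (d₁ ω)) P)
    (hc₂ : ∀ q ∈ T.admissible P d₁ d₂, Integrable (fun ω => T.cost₂ q (d₂ ω)) P)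
    -- the optimal dual solutions of both regional dispatch problems are unique
    (hu₁ : ∀ q ∈ interior (T.admissible P d₁ d₂),
      ∀ᵐ ω ∂P, ∃! p, T.R₁.IsOptimalDual q (d₁ ω) p)
    (hu₂ : ∀ q ∈ interior (T.admissible P d₁ d₂),
      ∀ᵐ ω ∂P, ∃! p, T.R₂.IsOptimalDual (-q) (d₂ ω) p) :
    -- the expected prices and the welfare integral are well defined
    (∀ q ∈ interior (T.admissible P d₁ d₂),
      Integrable (fun ω => T.price₁ q (d₁ ω)) P ∧ Integrable (fun ω => T.price₂ q (d₂ ω)) P) ∧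
    (∀ q ∈ T.admissible P d₁ d₂,
      IntervalIntegrable (fun x => T.expectedPrice₂ P d₂ x - T.expectedPrice₁ P d₁ x)
        volume 0 q) ∧
    -- both problems have exactly one optimizer, and it is the same
    (∃ qs : ℝ, (∀ q, T.IsStochasticOptimizer P d₁ d₂ q ↔ q = qs) ∧
      (∀ q, T.IsWelfareOptimizer P d₁ d₂ q ↔ q = qs)) ∧
    -- below the interface limit it is the intersection of the expected supply and demand curves
    (∀ q ∈ interior (T.admissible P d₁ d₂),
      T.IsStochasticOptimizer P d₁ d₂ q ↔ T.expectedPrice₁ P d₁ q = T.expectedPrice₂ P d₂ q) := by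
  have hc : ∀ q ∈ T.admissible P d₁ d₂,
      Integrable (fun ω => T.cost₁ q (d₁ ω) + T.cost₂ q (d₂ ω)) P :=
    fun q hq => (hc₁ q hq).add (hc₂ q hq)
  have hderiv := fun q (hq : q ∈ interior (T.admissible P d₁ d₂)) =>
    T.hasDerivAt_expectedCost hc₁ hc₂ hq (hu₁ q hq) (hu₂ q hq)
  have hW := T.strictConvexOn_expectedCost hc
  have hcl := T.isClosed_expectedCost_le hc
  have hwel := fun q (hq : q ∈ T.admissible P d₁ d₂) =>
    T.intervalIntegrable_and_welfare_eq hc (fun q hq => (hderiv q hq).2) h0 hq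
  obtain ⟨qs, hqs⟩ := hW.exists_unique_isMinOn_real ⟨0, h0⟩ hcl (T.isBounded_expectedCost_le hc)
  refine ⟨fun q hq => (hderiv q hq).1, fun q hq => (hwel q hq).1, ⟨qs, hqs, fun q => ?_⟩,
    fun q hq => ?_⟩
  · rw [← hqs q]
    refine and_congr_right fun hq => forall₂_congr fun x hx => ?_
    show T.welfare P d₁ d₂ x ≤ T.welfare P d₁ d₂ q ↔
      T.expectedCost P d₁ d₂ q ≤ T.expectedCost P d₁ d₂ x
    -- The constant expected cost at zero interchange cancels, so the two orders are opposite.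
    rw [(hwel x hx).2, (hwel q hq).2, sub_le_sub_iff_left]
  · rw [← sub_eq_zero, ← hW.convexOn.isMinOn_iff_deriv_eq_zero hq (hderiv q hq).2]
    exact and_iff_right (interior_subset hq)
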